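/- Let $U=\{z\in\mathbb C:|z|<1\}$, and let $A(\overline U)$ be the disc algebra, i.e. the complex Banach algebra of all continuous functions $f:\overline U\to\mathbb C$ that are holomorphic on $U$, with pointwise operations and the supremum norm. Let $\operatorname{Iso}(A(\overline U))$ be the set of all surjective complex-linear isometries of $A(\overline U)$ onto itself, and let $\operatorname{Aut}(A(\overline U))$ be the set of all continuous complex algebra automorphisms of $A(\overline U)$. For a set $\mathscr S$ of continuous complex-linear operators on a complex topological vector space $X$ put $$\operatorname{ref}_{to}\mathscr S=\{T:X\to X \text{ continuous and linear}: Tx\in\overline{\{Lx:L\in\mathscr S\}}\text{ for all }x\in X\},$$ where the bar denotes closure in $X$; $\mathscr S$ is called topologically reflexive if $\operatorname{ref}_{to}\mathscr S=\mathscr S$. Theorem. Both $\operatorname{Iso}(A(\overline U))$ and $\operatorname{Aut}(A(\overline U))$ are topologically reflexive. -/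

import Mathlib

/-- `S x = {L x : L ∈ S}`, the orbit of the vector `x` under a set `S` of operators. -/
def operatorOrbit {𝕜 X : Type*} [Semiring 𝕜] [AddCommMonoid X] [Module 𝕜 X] [TopologicalSpace X]
    (S : Set (X →L[𝕜] X)) (x : X) : Set X :=
  {y | ∃ L ∈ S, L x = y}

/-- The topological reflexive hull: the continuous linear operators `T` such that
`T x` lies in the closure of `S x` for every `x`. -/
def topologicalRef {𝕜 X : Type*} [Semiring 𝕜] [AddCommMonoid X] [Module 𝕜 X]
    [TopologicalSpace X] (S : Set (X →L[𝕜] X)) : Set (X →L[𝕜] X) :=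
  {T | ∀ x : X, T x ∈ closure (operatorOrbit S x)}

/-- A set of operators is topologically reflexive if it equals its topological reflexive hull. -/
def IsTopologicallyReflexive {𝕜 X : Type*} [Semiring 𝕜] [AddCommMonoid X] [Module 𝕜 X]
    [TopologicalSpace X] (S : Set (X →L[𝕜] X)) : Prop :=
  topologicalRef S = S

/-- The surjective linear isometries of `X`, as a set of continuous linear operators. -/
def isometryGroup (𝕜 X : Type*) [NormedField 𝕜] [SeminormedAddCommGroup X] [NormedSpace 𝕜 X] :
    Set (X →L[𝕜] X) :=
  {T | ∃ e : X ≃ₗᵢ[𝕜] X, ∀ x, T x = e x}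

/-- The algebra automorphisms of `A` that are homeomorphisms, as a set of continuous linear
operators. -/
def automorphismGroup (𝕜 A : Type*) [CommSemiring 𝕜] [Semiring A] [Algebra 𝕜 A]
    [TopologicalSpace A] : Set (A →L[𝕜] A) :=
  {T | ∃ e : A ≃A[𝕜] A, ∀ a, T a = e a}

/-- The disc algebra: the continuous complex functions on the closed unit disc that are
holomorphic on the open unit disc. It carries the supremum norm of
`C(Metric.closedBall (0 : ℂ) 1, ℂ)`. -/
def discAlgebra : Subalgebra ℂ C(Metric.closedBall (0 : ℂ) 1, ℂ) where
  carrier := {f | ∃ F : ℂ → ℂ, DifferentiableOn ℂ F (Metric.ball (0 : ℂ) 1) ∧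
    ∀ z : Metric.closedBall (0 : ℂ) 1, f z = F z}
  mul_mem' := by
    rintro f g ⟨F, hF, hf⟩ ⟨G, hG, hg⟩
    exact ⟨fun z => F z * G z, hF.mul hG, fun z => by simp [hf z, hg z]⟩
  add_mem' := by
    rintro f g ⟨F, hF, hf⟩ ⟨G, hG, hg⟩
    exact ⟨fun z => F z + G z, hF.add hG, fun z => by simp [hf z, hg z]⟩
  algebraMap_mem' := fun c =>
    ⟨fun _ => c, differentiableOn_const c, fun z => by simp⟩

open Metric Set Filter Topology
open scoped ComplexConjugate

/-! A surjective isometry is a unimodular constant times composition with a disc automorphism. The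
proof collects closed conditions that every such operator satisfies at a single vector; these pass
to any `T` in the hull (`mem_of_mem_topologicalRef`). They say that `T` preserves norms, `T 1` is a
unimodular constant `c`, `T discCoord` is unimodular on the circle, and `T discCoord` preserves
pseudo-hyperbolic distance to the origin.

At a boundary point `x`, the functional `f ↦ c⁻¹ (T f)(x)` is unital and contractive and takes a
unimodular value at the coordinate. By `contractive_functional_mul` it is multiplicative against the
coordinate, so density of polynomials gives `T f = c • (f ∘ ψ)` with `ψ = c⁻¹ • T discCoord`. So far
`ψ` could still be a power of the coordinate, say, with `T` not onto. The pseudo-hyperbolic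
condition excludes this: injectivity of `T` makes `ψ` nonconstant, and equality in the Schwarz lemma
makes it a disc automorphism (`PreservesPseudoHyperbolic.exists_inverse`).

Continuous automorphisms are isometric by comparing powers, so the second claim reduces to the
first, with `T 1 = 1` forcing `c = 1`. -/

/-! ### Point evaluations and the maximum principle -/

/-- The radial retraction of the plane onto the closed unit disc. -/
noncomputable def discRetract (z : ℂ) : closedBall (0 : ℂ) 1 :=
  ⟨z / (max 1 ‖z‖ : ℝ), by
    rw [mem_closedBall_zero_iff, norm_div, Complex.norm_real, Real.norm_eq_abs,
      abs_of_pos (lt_max_of_lt_left one_pos)]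
    exact div_le_one_of_le₀ (le_max_right _ _) (le_max_of_le_left zero_le_one)⟩

theorem coe_discRetract {z : ℂ} (hz : ‖z‖ ≤ 1) : (discRetract z : ℂ) = z := by
  simp [discRetract, max_eq_left hz]

theorem continuous_discRetract : Continuous discRetract := by
  refine Continuous.subtype_mk (continuous_id.div ?_ fun z => ?_) _
  · fun_prop
  · exact_mod_cast (lt_max_of_lt_left one_pos).ne'

/-- Evaluation of the elements of the disc algebra at a point of the closed unit disc, extended
to the plane through the radial retraction. -/
noncomputable def discEval (z : ℂ) : discAlgebra →ₐ[ℂ] ℂ where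
  toFun f := f.1 (discRetract z)
  map_one' := rfl
  map_mul' _ _ := rfl
  map_zero' := rfl
  map_add' _ _ := rfl
  commutes' _ := rfl

theorem discEval_smul (z c : ℂ) (f : discAlgebra) : discEval z (c • f) = c * discEval z f := rfl

theorem discEval_add (z : ℂ) (f g : discAlgebra) :
    discEval z (f + g) = discEval z f + discEval z g := rfl

theorem discEval_sub (z : ℂ) (f g : discAlgebra) :
    discEval z (f - g) = discEval z f - discEval z g := rfl

theorem discEval_mul (z : ℂ) (f g : discAlgebra) :
    discEval z (f * g) = discEval z f * discEval z g := rfl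

theorem discEval_pow (z : ℂ) (f : discAlgebra) (n : ℕ) :
    discEval z (f ^ n) = discEval z f ^ n := rfl

theorem discEval_one (z : ℂ) : discEval z (1 : discAlgebra) = 1 := rfl

theorem discEval_algebraMap (z c : ℂ) : discEval z (algebraMap ℂ discAlgebra c) = c := rfl

theorem discEval_apply (z : closedBall (0 : ℂ) 1) (f : discAlgebra) : discEval z f = f.1 z :=
  congrArg f.1 (Subtype.ext (coe_discRetract (mem_closedBall_zero_iff.1 z.2)))

theorem norm_discEval_le (z : ℂ) (f : discAlgebra) : ‖discEval z f‖ ≤ ‖f‖ :=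
  f.1.norm_coe_le_norm _

theorem continuous_discEval (f : discAlgebra) : Continuous fun z => discEval z f :=
  f.1.continuous.comp continuous_discRetract

theorem differentiableOn_discEval (f : discAlgebra) :
    DifferentiableOn ℂ (fun z => discEval z f) (ball 0 1) := by
  obtain ⟨F, hF, h⟩ := f.2
  refine hF.congr fun z hz => ?_
  rw [← h ⟨z, ball_subset_closedBall hz⟩, ← discEval_apply]

theorem diffContOnCl_discEval (f : discAlgebra) :
    DiffContOnCl ℂ (fun z => discEval z f) (ball 0 1) :=
  ⟨differentiableOn_discEval f, (continuous_discEval f).continuousOn⟩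

theorem discAlgebra_ext {f g : discAlgebra} (h : ∀ z : ℂ, ‖z‖ ≤ 1 → discEval z f = discEval z g) :
    f = g := by
  refine Subtype.ext (ContinuousMap.ext fun z => ?_)
  rw [← discEval_apply, ← discEval_apply, h z (mem_closedBall_zero_iff.1 z.2)]

theorem discNorm_le {f : discAlgebra} {C : ℝ} (hC : 0 ≤ C)
    (h : ∀ z : ℂ, ‖z‖ ≤ 1 → ‖discEval z f‖ ≤ C) : ‖f‖ ≤ C :=
  (ContinuousMap.norm_le _ hC).2 fun z =>
    (congrArg norm (discEval_apply z f)).symm.trans_le (h z (mem_closedBall_zero_iff.1 z.2))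

theorem exists_norm_discEval_eq (f : discAlgebra) :
    ∃ x : ℂ, ‖x‖ = 1 ∧ ‖discEval x f‖ = ‖f‖ := by
  obtain ⟨x, hx, hm⟩ := Complex.exists_mem_frontier_isMaxOn_norm isBounded_ball
    (nonempty_ball.2 one_pos) (diffContOnCl_discEval f)
  rw [frontier_ball _ one_ne_zero, mem_sphere_zero_iff_norm] at hx
  rw [closure_ball _ one_ne_zero] at hm
  exact ⟨x, hx, (norm_discEval_le x f).antisymm
    (discNorm_le (norm_nonneg _) fun z hz => hm (mem_closedBall_zero_iff.2 hz))⟩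

theorem discNorm_le_of_sphere {f : discAlgebra} {C : ℝ}
    (h : ∀ z : ℂ, ‖z‖ = 1 → ‖discEval z f‖ ≤ C) : ‖f‖ ≤ C := by
  obtain ⟨x, hx, e⟩ := exists_norm_discEval_eq f
  exact e ▸ h x hx

theorem discAlgebra_ext_sphere {f g : discAlgebra}
    (h : ∀ z : ℂ, ‖z‖ = 1 → discEval z f = discEval z g) : f = g := by
  rw [← sub_eq_zero, ← norm_le_zero_iff]
  exact discNorm_le_of_sphere fun z hz => by simp [discEval_sub, h z hz]

/-- An element of the disc algebra with unimodular value at an interior point is constant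
as soon as its norm is at most one. -/
theorem eq_algebraMap_of_norm_discEval_eq_one {f : discAlgebra} (hf : ‖f‖ ≤ 1) {z : ℂ}
    (hz : ‖z‖ < 1) (h : ‖discEval z f‖ = 1) : f = algebraMap ℂ discAlgebra (discEval z f) := by
  refine discAlgebra_ext fun w hw => ?_
  rw [discEval_algebraMap]
  have hm : IsMaxOn (norm ∘ fun z => discEval z f) (ball 0 1) z := fun w _ => by
    simpa [h] using (norm_discEval_le w f).trans hf
  have := Complex.eqOn_closure_of_isPreconnected_of_isMaxOn_norm
    (convex_ball (0 : ℂ) 1).isPreconnected isOpen_ball (diffContOnCl_discEval f)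
    (mem_ball_zero_iff.2 hz) hm
  rw [closure_ball _ one_ne_zero] at this
  exact this (mem_closedBall_zero_iff.2 hw)

/-- The element of the disc algebra given by a function on the plane. -/
def discMk (F : ℂ → ℂ) (hF : DiffContOnCl ℂ F (ball 0 1)) : discAlgebra :=
  ⟨⟨fun z => F z, by
    have h := hF.continuousOn
    rw [closure_ball _ one_ne_zero] at h
    exact continuousOn_iff_continuous_domRestrict.1 h⟩, F, hF.differentiableOn, fun _ => rfl⟩

theorem discEval_discMk {F : ℂ → ℂ} (hF : DiffContOnCl ℂ F (ball 0 1)) {z : ℂ} (hz : ‖z‖ ≤ 1) :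
    discEval z (discMk F hF) = F z :=
  discEval_apply ⟨z, mem_closedBall_zero_iff.2 hz⟩ _

/-- The coordinate function. -/
def discCoord : discAlgebra := discMk id differentiable_id.diffContOnCl

theorem discEval_discCoord {z : ℂ} (hz : ‖z‖ ≤ 1) : discEval z discCoord = z :=
  discEval_discMk _ hz

theorem norm_discCoord_le : ‖discCoord‖ ≤ 1 :=
  discNorm_le zero_le_one fun z hz => by rwa [discEval_discCoord hz]


/-! ### Density of the polynomials -/

/-- Evaluation as a continuous linear functional. -/
noncomputable def discEvalCLM (z : ℂ) : discAlgebra →L[ℂ] ℂ :=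
  (discEval z).toLinearMap.mkContinuous 1 fun f =>
    (norm_discEval_le z f).trans_eq (one_mul _).symm

/-- The polynomials are dense in the disc algebra. -/
theorem dense_span_discCoord_pow :
    Dense (Submodule.span ℂ (range fun n : ℕ => discCoord ^ n) : Set discAlgebra) := by
  intro f
  rw [Metric.mem_closure_iff]
  intro ε hε
  have huc := (isCompact_closedBall (0 : ℂ) 1).uniformContinuousOn_of_continuous
    (continuous_discEval f).continuousOn
  rw [Metric.uniformContinuousOn_iff] at huc
  obtain ⟨δ, hδ, huc⟩ := huc (ε / 3) (by positivity)
  -- The dilate `f(r z)` is close to `f` by uniform continuity; since `r < s < 1`, the Taylor sums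
  -- converge uniformly where the dilate samples `f`.
  obtain ⟨r, hr0, hr1⟩ : ∃ r : ℝ, max 0 (1 - δ) < r ∧ r < 1 :=
    exists_between (max_lt one_pos (by linarith))
  obtain ⟨s, hrs, hs1⟩ := exists_between hr1
  have hrpos : 0 < r := (le_max_left _ _).trans_lt hr0
  have hrδ : 1 - r < δ := by linarith [(le_max_right 0 (1 - δ)).trans_lt hr0]
  have hps : HasFPowerSeriesOnBall (fun z => discEval z f)
      (cauchyPowerSeries (fun z => discEval z f) 0 ((1 : NNReal) : ℝ)) 0 (1 : NNReal) :=
    DiffContOnCl.hasFPowerSeriesOnBall (diffContOnCl_discEval f) one_pos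
  set p := cauchyPowerSeries (fun z => discEval z f) 0 ((1 : NNReal) : ℝ)
  have hu := hps.tendstoUniformlyOn' (r' := ⟨s, (hrpos.trans hrs).le⟩)
    (ENNReal.coe_lt_coe.2 (NNReal.coe_lt_coe.1 hs1))
  rw [Metric.tendstoUniformlyOn_iff] at hu
  obtain ⟨n, hn⟩ := (hu (ε / 3) (by positivity)).exists
  refine ⟨∑ k ∈ Finset.range n, (p.coeff k * r ^ k) • discCoord ^ k,
    Submodule.sum_mem _ fun k _ => Submodule.smul_mem _ _ (Submodule.subset_span ⟨k, rfl⟩), ?_⟩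
  rw [dist_eq_norm]
  refine (discNorm_le (C := ε / 3 + ε / 3) (by positivity) fun z hz => ?_).trans_lt (by linarith)
  have hrz : ‖r * z‖ ≤ r := by
    rw [norm_mul, Complex.norm_real, Real.norm_of_nonneg hrpos.le]
    exact mul_le_of_le_one_right hrpos.le hz
  have h1 := huc z (mem_closedBall_zero_iff.2 hz) (r * z)
    (mem_closedBall_zero_iff.2 (hrz.trans hr1.le)) (by
      rw [dist_eq_norm, show z - r * z = ((1 - r : ℝ) : ℂ) * z by push_cast; ring, norm_mul,
        Complex.norm_real, Real.norm_of_nonneg (by linarith)]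
      exact (mul_le_of_le_one_right (by linarith) hz).trans_lt hrδ)
  have h2 := hn (r * z) (mem_ball_zero_iff.2 (hrz.trans_lt hrs))
  have h3 : p.partialSum n (r * z - 0) =
      discEval z (∑ k ∈ Finset.range n, (p.coeff k * r ^ k) • discCoord ^ k) := by
    simp only [FormalMultilinearSeries.partialSum, map_sum, discEval_smul, discEval_pow,
      discEval_discCoord hz, sub_zero, FormalMultilinearSeries.apply_eq_pow_smul_coeff, smul_eq_mul]
    exact Finset.sum_congr rfl fun k _ => by ring
  rw [h3] at h2
  rw [discEval_sub, ← dist_eq_norm]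
  exact (dist_triangle _ _ _).trans (add_le_add h1.le h2.le)

theorem discAlgebra_clm_ext {E : Type*} [NormedAddCommGroup E] [NormedSpace ℂ E]
    {S T : discAlgebra →L[ℂ] E} (h : ∀ n : ℕ, S (discCoord ^ n) = T (discCoord ^ n)) : S = T :=
  ContinuousLinearMap.ext_on dense_span_discCoord_pow (by rintro _ ⟨n, rfl⟩; exact h n)

/-! ### The form of a surjective isometry -/

/-- Strict convexity of the disc, read off the parallelogram law. -/
theorem eq_of_two_le_norm_add {a b : ℂ} (ha : ‖a‖ ≤ 1) (hb : ‖b‖ ≤ 1) (h : 2 ≤ ‖a + b‖) :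
    a = b ∧ ‖b‖ = 1 := by
  have hp := parallelogram_law_with_norm ℝ a b
  have h1 : ‖a - b‖ * ‖a - b‖ ≤ 0 := by nlinarith [norm_nonneg a, norm_nonneg b]
  have h2 : a = b := by
    rw [← sub_eq_zero, ← norm_eq_zero]
    exact mul_self_eq_zero.1 (h1.antisymm (mul_self_nonneg _))
  exact ⟨h2, hb.antisymm (by linarith [norm_add_le a b, h2 ▸ ha])⟩

theorem mul_conj_of_norm_one {x : ℂ} (hx : ‖x‖ = 1) : x * conj x = 1 := by
  rw [Complex.mul_conj, Complex.normSq_eq_norm_sq, hx]; norm_num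

theorem norm_discCoord_pow_le (n : ℕ) : ‖discCoord ^ n‖ ≤ 1 :=
  discNorm_le zero_le_one fun z hz => by
    rw [discEval_pow, discEval_discCoord hz, norm_pow]; exact pow_le_one₀ (norm_nonneg _) hz

/-- Composing a surjective isometry with evaluation at a boundary point gives a unimodular
multiple of an evaluation at a boundary point. -/
theorem exists_discEval_isometry (S : discAlgebra ≃ₗᵢ[ℂ] discAlgebra) {x : ℂ} (hx : ‖x‖ = 1) :
    ∃ y c : ℂ, ‖y‖ = 1 ∧ ‖c‖ = 1 ∧ ∀ f, discEval x (S f) = c * discEval y f := by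
  obtain ⟨p, hp⟩ : ∃ p : discAlgebra, ∀ z : ℂ, ‖z‖ ≤ 1 → discEval z p = (1 + conj x * z) / 2 :=
    ⟨(1 / 2 : ℂ) • (1 + conj x • discCoord), fun z hz => by
      rw [discEval_smul, discEval_add, discEval_one, discEval_smul, discEval_discCoord hz]; ring⟩
  have hxz : ∀ {z : ℂ}, ‖z‖ ≤ 1 → ‖conj x * z‖ ≤ 1 := fun hz => by
    rwa [norm_mul, RCLike.norm_conj, hx, one_mul]
  have hpn : ‖p‖ ≤ 1 := discNorm_le zero_le_one fun z hz => by
    rw [hp z hz, norm_div, RCLike.norm_ofNat, div_le_one two_pos]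
    refine (norm_add_le _ _).trans ?_
    rw [norm_one]
    linarith [hxz hz]
  have hpx : discEval x p = 1 := by
    rw [hp x hx.le, mul_comm, mul_conj_of_norm_one hx]; norm_num
  have hpeak : ∀ z : ℂ, ‖z‖ ≤ 1 → ‖discEval z p‖ = 1 → z = x := fun z hz h => by
    rw [hp z hz, norm_div, RCLike.norm_ofNat, div_eq_one_iff_eq two_ne_zero] at h
    have := (eq_of_two_le_norm_add norm_one.le (hxz hz) h.ge).1
    rw [← one_mul z, ← mul_conj_of_norm_one hx, mul_assoc, ← this, mul_one]
  obtain ⟨y, hy, hyg⟩ := exists_norm_discEval_eq (S.symm p)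
  rw [S.symm.norm_map, hpn.antisymm (by
    have := norm_discEval_le x p
    rwa [hpx, norm_one] at this)] at hyg
  set c := discEval y (S.symm p)
  -- At `y` the functions `f` and `S.symm p` agree, so `f + S.symm p` has norm at least 2, and so
  -- has `S f + p`. Where the latter attains its norm, `p` is unimodular; since `p` peaks only at
  -- `x`, that point is `x`.
  have key : ∀ f : discAlgebra, ‖f‖ ≤ 1 → discEval y f = c → discEval x (S f) = 1 := by
    intro f hf hfy
    obtain ⟨z, hz, hzn⟩ := exists_norm_discEval_eq (S f + p)
    have h2 : 2 ≤ ‖discEval z (S f) + discEval z p‖ := by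
      rw [← discEval_add, hzn, ← S.apply_symm_apply p, ← S.map_add, S.norm_map]
      refine le_trans ?_ (norm_discEval_le y _)
      rw [discEval_add, hfy, ← two_mul, norm_mul, hyg]; norm_num
    obtain ⟨h3, h4⟩ := eq_of_two_le_norm_add
      ((norm_discEval_le z (S f)).trans ((S.norm_map f).trans_le hf))
      ((norm_discEval_le z p).trans hpn) h2
    obtain rfl := hpeak z hz.le h4
    rw [h3, hpx]
  refine ⟨y, conj c, hy, by rwa [RCLike.norm_conj], fun f => ?_⟩
  have hyc := mul_conj_of_norm_one hy
  have hcc := mul_conj_of_norm_one hyg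
  have hS : (discEvalCLM x).comp (S : discAlgebra →L[ℂ] discAlgebra) = conj c • discEvalCLM y := by
    refine discAlgebra_clm_ext fun n => ?_
    have h1 := key ((c * conj y ^ n) • discCoord ^ n) (by
      rw [norm_smul, norm_mul, norm_pow, RCLike.norm_conj, hy, hyg, one_pow, one_mul, one_mul]
      exact norm_discCoord_pow_le n) (by
      rw [discEval_smul, discEval_pow, discEval_discCoord hy.le, mul_assoc, ← mul_pow,
        mul_comm (conj y), hyc, one_pow, mul_one])
    rw [S.map_smul, discEval_smul] at h1
    change discEval x (S (discCoord ^ n)) = conj c * discEval y (discCoord ^ n)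
    rw [discEval_pow, discEval_discCoord hy.le]
    calc discEval x (S (discCoord ^ n))
        = (c * conj c) * (y * conj y) ^ n * discEval x (S (discCoord ^ n)) := by
          rw [hyc, hcc, one_pow, one_mul, one_mul]
      _ = conj c * y ^ n * (c * conj y ^ n * discEval x (S (discCoord ^ n))) := by ring
      _ = _ := by rw [h1, mul_one]
  exact DFunLike.congr_fun hS f

/-- At a boundary point both sides are `c ^ 2` times the value of `f * g` at a common point `y`. -/
theorem isometry_mul (S : discAlgebra ≃ₗᵢ[ℂ] discAlgebra) (f g : discAlgebra) :
    S f * S g = S 1 * S (f * g) := by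
  refine discAlgebra_ext_sphere fun x hx => ?_
  obtain ⟨y, c, -, -, h⟩ := exists_discEval_isometry S hx
  simp only [discEval_mul, h, discEval_one]
  ring

/-- A surjective isometry maps the unit to a unimodular constant. -/
theorem isometry_one (S : discAlgebra ≃ₗᵢ[ℂ] discAlgebra) :
    ∃ c : ℂ, ‖c‖ = 1 ∧ S 1 = algebraMap ℂ discAlgebra c := by
  have hsph : ∀ x : ℂ, ‖x‖ = 1 → ‖discEval x (S 1)‖ = 1 := fun x hx => by
    obtain ⟨y, c, -, hc, h⟩ := exists_discEval_isometry S hx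
    rw [h, discEval_one, mul_one, hc]
  -- This is the inverse of `S 1`. Both factors have norm at most 1, so at the origin both are
  -- unimodular, and the maximum principle makes `S 1` constant.
  set w := S (S.symm 1 * S.symm 1)
  have hw : S 1 * w = 1 := by
    rw [← isometry_mul, S.apply_symm_apply, one_mul]
  have hu1 : ‖S 1‖ ≤ 1 := discNorm_le_of_sphere fun x hx => (hsph x hx).le
  have hw1 : ‖w‖ ≤ 1 := discNorm_le_of_sphere fun x hx => by
    have := congrArg (fun f => ‖discEval x f‖) hw
    simp only [discEval_mul, norm_mul, hsph x hx, discEval_one, norm_one, one_mul] at this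
    exact this.le
  have h0 : ‖discEval 0 (S 1)‖ = 1 := by
    have := congrArg (fun f => ‖discEval 0 f‖) hw
    simp only [discEval_mul, norm_mul, discEval_one, norm_one] at this
    have h1 := (norm_discEval_le 0 (S 1)).trans hu1
    have h2 := (norm_discEval_le 0 w).trans hw1
    nlinarith [norm_nonneg (discEval 0 (S 1))]
  exact ⟨_, h0, eq_algebraMap_of_norm_discEval_eq_one hu1 (by simp) h0⟩

theorem norm_discEval_isometry_discCoord (S : discAlgebra ≃ₗᵢ[ℂ] discAlgebra) {x : ℂ}
    (hx : ‖x‖ = 1) : ‖discEval x (S discCoord)‖ = 1 := by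
  obtain ⟨y, c, hy, hc, h⟩ := exists_discEval_isometry S hx
  rw [h, discEval_discCoord hy.le, norm_mul, hy, hc, one_mul]

/-- A continuous linear operator that sends the powers of the coordinate to constant multiples of
the powers of a function is a weighted composition operator. -/
theorem discEval_eq_of_discCoord_pow {T : discAlgebra →L[ℂ] discAlgebra} {c : ℂ}
    {φ : discAlgebra} (hφ : ‖φ‖ ≤ 1) (h : ∀ n : ℕ, T (discCoord ^ n) = c • φ ^ n) (z : ℂ)
    (f : discAlgebra) : discEval z (T f) = c * discEval (discEval z φ) f := by
  have : (discEvalCLM z).comp T = c • discEvalCLM (discEval z φ) :=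
    discAlgebra_clm_ext fun n => by
      change discEval z (T (discCoord ^ n)) = c * discEval (discEval z φ) (discCoord ^ n)
      rw [h, discEval_smul, discEval_pow, discEval_pow,
        discEval_discCoord ((norm_discEval_le z φ).trans hφ)]
  exact DFunLike.congr_fun this f

theorem isometry_eq_comp (S : discAlgebra ≃ₗᵢ[ℂ] discAlgebra) :
    ∃ (c : ℂ) (φ : discAlgebra), ‖c‖ = 1 ∧ ‖φ‖ ≤ 1 ∧
      ∀ z f, discEval z (S f) = c * discEval (discEval z φ) f := by
  obtain ⟨c, hc, h1⟩ := isometry_one S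
  have hc0 : c ≠ 0 := norm_ne_zero_iff.1 (hc ▸ one_ne_zero)
  have hφ : ‖c⁻¹ • S discCoord‖ ≤ 1 := by
    rw [norm_smul, norm_inv, hc, inv_one, one_mul, S.norm_map]
    exact norm_discCoord_le
  refine ⟨c, c⁻¹ • S discCoord, hc, hφ, fun z f =>
    discEval_eq_of_discCoord_pow (T := (S : discAlgebra →L[ℂ] discAlgebra)) hφ (fun n => ?_) z f⟩
  change S (discCoord ^ n) = _
  induction n with
  | zero => rw [pow_zero, pow_zero, h1, Algebra.algebraMap_eq_smul_one]
  | succ n ih =>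
    have := isometry_mul S (discCoord ^ n) discCoord
    rw [← pow_succ, h1, ← Algebra.smul_def, ih] at this
    rw [← inv_smul_smul₀ hc0 (S (discCoord ^ (n + 1))), ← this, pow_succ, smul_mul_assoc,
      inv_smul_smul₀ hc0, mul_smul_comm, smul_inv_smul₀ hc0]

/-! ### Composition operators, the Schwarz lemma and Möbius maps -/

/-- The composition operator induced by a self-map of the disc. -/
noncomputable def discComp (φ : discAlgebra) (hφ : ∀ z : ℂ, ‖z‖ < 1 → ‖discEval z φ‖ < 1) :
    discAlgebra →ₐ[ℂ] discAlgebra where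
  toFun f := discMk (fun z => discEval (discEval z φ) f)
    ⟨(differentiableOn_discEval f).comp (differentiableOn_discEval φ) fun z hz =>
        mem_ball_zero_iff.2 (hφ z (mem_ball_zero_iff.1 hz)),
      ((continuous_discEval f).comp (continuous_discEval φ)).continuousOn⟩
  map_one' := rfl
  map_mul' _ _ := rfl
  map_zero' := rfl
  map_add' _ _ := rfl
  commutes' _ := rfl

theorem discEval_discComp {φ : discAlgebra} (hφ : ∀ z : ℂ, ‖z‖ < 1 → ‖discEval z φ‖ < 1)
    (f : discAlgebra) {z : ℂ} (hz : ‖z‖ ≤ 1) :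
    discEval z (discComp φ hφ f) = discEval (discEval z φ) f :=
  discEval_discMk _ hz

theorem norm_discComp_le {φ : discAlgebra} (hφ : ∀ z : ℂ, ‖z‖ < 1 → ‖discEval z φ‖ < 1)
    (f : discAlgebra) : ‖discComp φ hφ f‖ ≤ ‖f‖ :=
  discNorm_le (norm_nonneg f) fun z hz => by
    rw [discEval_discComp hφ f hz]; exact norm_discEval_le _ f

/-- A unimodular value inside the disc would make `φ` constant, contradicting the value at the
origin. -/
theorem norm_discEval_lt_one {φ : discAlgebra} (hφ : ‖φ‖ ≤ 1) (h0 : ‖discEval 0 φ‖ < 1)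
    (z : ℂ) (hz : ‖z‖ < 1) : ‖discEval z φ‖ < 1 := by
  refine ((norm_discEval_le z φ).trans hφ).lt_of_ne fun h => h0.ne ?_
  rw [eq_algebraMap_of_norm_discEval_eq_one hφ hz h, discEval_algebraMap, h]

/-- Schwarz lemma, with the boundary circle included. -/
theorem norm_discEval_le_norm {h : discAlgebra} (hh : ‖h‖ ≤ 1) (h0 : discEval 0 h = 0) {z : ℂ}
    (hz : ‖z‖ ≤ 1) : ‖discEval z h‖ ≤ ‖z‖ := by
  rcases hz.lt_or_eq with hz | hz
  · exact Complex.norm_le_norm_of_mapsTo_ball (differentiableOn_discEval h)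
      (fun w _ => mem_closedBall_zero_iff.2 ((norm_discEval_le w h).trans hh)) h0 hz
  · exact ((norm_discEval_le z h).trans hh).trans_eq hz.symm

theorem one_sub_conj_mul_ne_zero {a z : ℂ} (ha : ‖a‖ < 1) (hz : ‖z‖ ≤ 1) :
    1 - conj a * z ≠ 0 := by
  intro h
  have : ‖conj a * z‖ = 1 := by rw [← sub_eq_zero.1 h, norm_one]
  rw [norm_mul, RCLike.norm_conj] at this
  nlinarith [norm_nonneg a, norm_nonneg z]

theorem norm_sub_sq_eq_one_sub_conj_mul (a z : ℂ) :
    ‖z - a‖ ^ 2 = ‖1 - conj a * z‖ ^ 2 - (1 - ‖a‖ ^ 2) * (1 - ‖z‖ ^ 2) := by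
  simp only [← Complex.normSq_eq_norm_sq, Complex.normSq_apply, Complex.sub_re, Complex.sub_im,
    Complex.mul_re, Complex.mul_im, Complex.conj_re, Complex.conj_im, Complex.one_re,
    Complex.one_im]
  ring

/-- The Möbius transformation of the disc that vanishes at `a`. -/
noncomputable def discMobius (a : ℂ) (ha : ‖a‖ < 1) : discAlgebra :=
  discMk (fun z => (z - a) / (1 - conj a * z)) <| by
    refine DifferentiableOn.diffContOnCl ?_
    rw [closure_ball _ one_ne_zero]
    refine DifferentiableOn.div (by fun_prop) (by fun_prop) fun z hz => ?_
    exact one_sub_conj_mul_ne_zero ha (mem_closedBall_zero_iff.1 hz)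

theorem discEval_discMobius {a z : ℂ} (ha : ‖a‖ < 1) (hz : ‖z‖ ≤ 1) :
    discEval z (discMobius a ha) = (z - a) / (1 - conj a * z) :=
  discEval_discMk _ hz

theorem norm_discMobius_le {a : ℂ} (ha : ‖a‖ < 1) : ‖discMobius a ha‖ ≤ 1 :=
  discNorm_le zero_le_one fun z hz => by
    rw [discEval_discMobius ha hz, norm_div]
    refine div_le_one_of_le₀ ((sq_le_sq₀ (norm_nonneg _) (norm_nonneg _)).1 ?_) (norm_nonneg _)
    rw [norm_sub_sq_eq_one_sub_conj_mul]
    have h1 : 0 ≤ 1 - ‖a‖ ^ 2 := by nlinarith [norm_nonneg a]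
    have h2 : 0 ≤ 1 - ‖z‖ ^ 2 := by nlinarith [norm_nonneg z]
    linarith [mul_nonneg h1 h2]

theorem norm_discEval_discMobius_lt {a : ℂ} (ha : ‖a‖ < 1) :
    ∀ z : ℂ, ‖z‖ < 1 → ‖discEval z (discMobius a ha)‖ < 1 := by
  refine norm_discEval_lt_one (norm_discMobius_le ha) ?_
  rw [discEval_discMobius ha (by simp)]
  simpa using ha

theorem discEval_discMobius_neg {a z : ℂ} (ha : ‖a‖ < 1) (hz : ‖z‖ ≤ 1) :
    discEval (discEval z (discMobius a ha)) (discMobius (-a) (by rwa [norm_neg])) = z := by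
  have hn := one_sub_conj_mul_ne_zero ha hz
  have hm := (norm_discEval_le z _).trans (norm_discMobius_le ha)
  have h2 := one_sub_conj_mul_ne_zero (a := -a) (by rwa [norm_neg]) hm
  rw [discEval_discMobius _ hm, div_eq_iff h2, map_neg]
  have := (eq_div_iff hn).1 (discEval_discMobius ha hz)
  linear_combination this

/-! ### Pseudo-hyperbolic distance to the origin -/

/-- `φ` preserves the pseudo-hyperbolic distance to the origin. -/
def PreservesPseudoHyperbolic (φ : discAlgebra) : Prop :=
  ∀ z : ℂ, ‖z‖ ≤ 1 →
    ‖discEval z φ - discEval 0 φ‖ = ‖z‖ * ‖1 - conj (discEval 0 φ) * discEval z φ‖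

theorem continuous_discEval_left (z : ℂ) : Continuous fun f : discAlgebra => discEval z f :=
  (discEvalCLM z).continuous

/-- With the denominator cleared, the condition equates continuous functions of `φ`. It also holds
for unimodular constants, where the quotient would be undefined. -/
theorem isClosed_preservesPseudoHyperbolic : IsClosed {φ | PreservesPseudoHyperbolic φ} := by
  simp only [PreservesPseudoHyperbolic, ofPred_forall]
  refine isClosed_iInter fun z => isClosed_iInter fun _ => isClosed_eq ?_ ?_
  · exact ((continuous_discEval_left z).sub (continuous_discEval_left 0)).norm
  · exact continuous_const.mul (continuous_const.sub
      ((Complex.continuous_conj.comp (continuous_discEval_left 0)).mul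
        (continuous_discEval_left z))).norm

theorem PreservesPseudoHyperbolic.smul {φ : discAlgebra} (h : PreservesPseudoHyperbolic φ) {c : ℂ}
    (hc : ‖c‖ = 1) : PreservesPseudoHyperbolic (c • φ) := fun z hz => by
  rw [discEval_smul, discEval_smul, ← mul_sub, norm_mul, hc, one_mul, map_mul, h z hz]
  congr 3
  linear_combination conj (discEval 0 φ) * discEval z φ * -mul_conj_of_norm_one hc

/-- A self-map of the closed disc in the disc algebra with a left inverse in the disc algebra
preserves the pseudo-hyperbolic distance to the origin. -/
theorem preservesPseudoHyperbolic_of_leftInverse {φ χ : discAlgebra} (hφ : ‖φ‖ ≤ 1)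
    (hχ : ‖χ‖ ≤ 1) (h : ∀ z : ℂ, ‖z‖ ≤ 1 → discEval (discEval z φ) χ = z) :
    PreservesPseudoHyperbolic φ := by
  have h01 : ‖(0 : ℂ)‖ ≤ 1 := by simp
  have ha : ‖discEval 0 φ‖ < 1 := by
    refine ((norm_discEval_le 0 φ).trans hφ).lt_of_ne fun h1 => ?_
    have h2 := h 1 norm_one.le
    rw [eq_algebraMap_of_norm_discEval_eq_one hφ (by simp) h1, discEval_algebraMap, h 0 h01] at h2
    exact zero_ne_one h2
  set a := discEval 0 φ
  have hφ1 : ∀ z, ‖discEval z φ‖ ≤ 1 := fun z => (norm_discEval_le z φ).trans hφ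
  have hφb := norm_discEval_lt_one hφ ha
  -- Möbius maps move `φ(0)` to the origin: `p` and `k` both fix 0 and `k ∘ p` is the identity, so
  -- the Schwarz lemma for each gives `‖p(z)‖ = ‖z‖`.
  set p := discComp φ hφb (discMobius a ha)
  have ha' : ‖-a‖ < 1 := by rwa [norm_neg]
  set k := discComp (discMobius (-a) ha') (norm_discEval_discMobius_lt ha') χ
  have hp : ‖p‖ ≤ 1 := (norm_discComp_le _ _).trans (norm_discMobius_le ha)
  have hk : ‖k‖ ≤ 1 := (norm_discComp_le _ _).trans hχ
  have hpz : ∀ z : ℂ, ‖z‖ ≤ 1 →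
      discEval z p = (discEval z φ - a) / (1 - conj a * discEval z φ) := fun z hz => by
    rw [discEval_discComp _ _ hz, discEval_discMobius ha (hφ1 z)]
  have hkp : ∀ z : ℂ, ‖z‖ ≤ 1 → discEval (discEval z p) k = z := fun z hz => by
    rw [discEval_discComp _ _ ((norm_discEval_le z p).trans hp), discEval_discComp _ _ hz,
      discEval_discMobius_neg ha (hφ1 z), h z hz]
  have hp0 : discEval 0 p = 0 := by rw [hpz 0 h01, sub_self, zero_div]
  have hk0 : discEval 0 k = 0 := by
    have := hkp 0 h01
    rwa [hp0] at this
  intro z hz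
  have heq : ‖discEval z p‖ = ‖z‖ := by
    refine (norm_discEval_le_norm hp hp0 hz).antisymm ?_
    conv_lhs => rw [← hkp z hz]
    exact norm_discEval_le_norm hk hk0 ((norm_discEval_le z p).trans hp)
  rw [hpz z hz, norm_div, div_eq_iff (norm_ne_zero_iff.2
    (one_sub_conj_mul_ne_zero ha (hφ1 z)))] at heq
  exact heq

theorem preservesPseudoHyperbolic_isometry (S : discAlgebra ≃ₗᵢ[ℂ] discAlgebra) :
    PreservesPseudoHyperbolic (S discCoord) := by
  obtain ⟨c, φ, hc, hφ, hS⟩ := isometry_eq_comp S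
  obtain ⟨d, χ, -, hχ, hS'⟩ := isometry_eq_comp S.symm
  have hcd : ∀ z f, discEval z f = c * (d * discEval (discEval (discEval z φ) χ) f) := fun z f => by
    rw [← hS', ← hS, S.apply_symm_apply]
  have h1 : c * d = 1 := by
    have := hcd 0 1
    rw [discEval_one, discEval_one, mul_one] at this
    exact this.symm
  have hinv : ∀ z : ℂ, ‖z‖ ≤ 1 → discEval (discEval z φ) χ = z := fun z hz => by
    have := hcd z discCoord
    rw [discEval_discCoord hz, discEval_discCoord ((norm_discEval_le _ χ).trans hχ), ← mul_assoc,
      h1, one_mul] at this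
    exact this.symm
  have : S discCoord = c • φ := discAlgebra_ext fun z _ => by
    rw [hS, discEval_smul, discEval_discCoord ((norm_discEval_le z φ).trans hφ)]
  exact this ▸ (preservesPseudoHyperbolic_of_leftInverse hφ hχ hinv).smul hc

/-- A nonconstant element of the disc algebra that preserves the pseudo-hyperbolic distance to the
origin is an automorphism of the disc. -/
theorem PreservesPseudoHyperbolic.exists_inverse {ψ : discAlgebra}
    (h : PreservesPseudoHyperbolic ψ) (hψ : ‖ψ‖ ≤ 1) (h0 : ‖discEval 0 ψ‖ < 1) :
    ∃ χ : discAlgebra, (∀ z : ℂ, ‖z‖ < 1 → ‖discEval z χ‖ < 1) ∧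
      (∀ z : ℂ, ‖z‖ ≤ 1 → discEval (discEval z ψ) χ = z) ∧
      ∀ z : ℂ, ‖z‖ ≤ 1 → discEval (discEval z χ) ψ = z := by
  set a := discEval 0 ψ
  have hψ1 : ∀ z, ‖discEval z ψ‖ ≤ 1 := fun z => (norm_discEval_le z ψ).trans hψ
  set p := discComp ψ (norm_discEval_lt_one hψ h0) (discMobius a h0)
  have hpm : ∀ z : ℂ, ‖z‖ ≤ 1 → discEval z p = discEval (discEval z ψ) (discMobius a h0) :=
    fun z hz => discEval_discComp _ _ hz
  have hp : ∀ z : ℂ, ‖z‖ ≤ 1 → ‖discEval z p‖ = ‖z‖ := fun z hz => by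
    rw [hpm z hz, discEval_discMobius h0 (hψ1 z), norm_div, div_eq_iff (norm_ne_zero_iff.2
      (one_sub_conj_mul_ne_zero h0 (hψ1 z))), h z hz]
  have hp0 : discEval 0 p = 0 := by rw [← norm_eq_zero, hp 0 (by simp), norm_zero]
  -- Equality in the Schwarz lemma; `1 / 2` is just some nonzero interior point. Continuity extends
  -- the formula to the circle.
  obtain ⟨C, hC, hpC⟩ : ∃ C : ℂ, ‖C‖ = 1 ∧ ∀ z : ℂ, ‖z‖ ≤ 1 → discEval z p = C * z := by
    obtain ⟨C, hC, hE⟩ := Complex.affine_of_mapsTo_ball_of_exists_norm_dslope_eq_div' (R₂ := 1)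
      (differentiableOn_discEval p) (fun z hz => by
        rw [hp0, mem_closedBall_zero_iff, hp z (mem_ball_zero_iff.1 hz).le]
        exact (mem_ball_zero_iff.1 hz).le) ⟨1 / 2, mem_ball_zero_iff.2 (by norm_num), by
        rw [dslope_of_ne _ (by norm_num), slope_def_module, hp0, sub_zero, sub_zero, norm_smul,
          hp _ (by norm_num)]
        norm_num⟩
    have hE' := hE.of_subset_closure (continuous_discEval p).continuousOn
      (Continuous.continuousOn (by fun_prop)) subset_closure Subset.rfl
    rw [closure_ball _ one_ne_zero] at hE'
    refine ⟨C, by simpa using hC, fun z hz => ?_⟩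
    have := hE' (mem_closedBall_zero_iff.2 hz)
    simp only [hp0, zero_add, sub_zero, smul_eq_mul] at this
    rw [this, mul_comm]
  have hCC := mul_conj_of_norm_one hC
  have hχ : ∀ z, ‖discEval z (conj C • discMobius a h0)‖ = ‖discEval z (discMobius a h0)‖ :=
    fun z => by rw [discEval_smul, norm_mul, RCLike.norm_conj, hC, one_mul]
  refine ⟨conj C • discMobius a h0, fun z hz => ?_, fun z hz => ?_, fun z hz => ?_⟩
  · rw [hχ]; exact norm_discEval_discMobius_lt h0 z hz
  · rw [discEval_smul, ← hpm z hz, hpC z hz, ← mul_assoc, mul_comm (conj C), hCC, one_mul]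
  · have hw : ‖discEval z (conj C • discMobius a h0)‖ ≤ 1 := by
      rw [hχ]; exact (norm_discEval_le _ _).trans (norm_discMobius_le h0)
    rw [← discEval_discMobius_neg h0 (hψ1 _), ← hpm _ hw, hpC _ hw, discEval_smul, ← mul_assoc, hCC,
      one_mul, discEval_discMobius_neg h0 hz]

/-! ### Multiplicativity from contractivity -/

/-- If a unital contractive functional takes the value one at an element of the unit ball, it is
invariant under multiplication by this element. -/
theorem contractive_functional_mul {ξ : discAlgebra →L[ℂ] ℂ} (hξ : ∀ f, ‖ξ f‖ ≤ ‖f‖)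
    (h1 : ξ 1 = 1) {h : discAlgebra} (hh : ‖h‖ ≤ 1) (hξh : ξ h = 1) (g : discAlgebra) :
    ξ (h * g) = ξ g := by
  set q := g - h * g
  suffices hq : ξ q = 0 by rw [ξ.map_sub] at hq; exact (sub_eq_zero.1 hq).symm
  by_contra hd
  set d := ξ q
  set M := ‖g‖
  set D := ‖d‖
  have hD : 0 < D := norm_pos_iff.2 hd
  have hM : 0 ≤ M := norm_nonneg g
  -- Perturb `(1 + h) / 2` by a small multiple of `q = (1 - h) * g`. By Cauchy–Schwarz the norm
  -- exceeds 1 only to second order in `t`, while `ξ` grows to first order. This `t` gives `k ^ 2 <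
  -- t * D ^ 2`, which suffices for a contradiction.
  set t : ℝ := (4 * M ^ 2 + 1)⁻¹
  have ht : 0 < t := by positivity
  set k : ℝ := 2 * t * D * M
  set f : discAlgebra := (1 / 2 : ℂ) • (1 + h) + ((t : ℂ) * conj d) • q
  have hval : ξ f = ((1 + t * D ^ 2 : ℝ) : ℂ) := by
    rw [ξ.map_add, ξ.map_smul, ξ.map_smul, ξ.map_add, h1, hξh, smul_eq_mul, smul_eq_mul, mul_assoc,
      mul_comm (conj d), Complex.mul_conj, Complex.normSq_eq_norm_sq]
    push_cast
    ring
  have hf : ‖f‖ ≤ √(1 + k ^ 2) := by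
    refine discNorm_le (Real.sqrt_nonneg _) fun z _ => Real.le_sqrt_of_sq_le ?_
    set w := discEval z h
    have hw : ‖w‖ ≤ 1 := (norm_discEval_le z h).trans hh
    have hpar := parallelogram_law_with_norm ℝ (1 : ℂ) w
    rw [norm_one] at hpar
    have hb : ‖discEval z f‖ ≤ ‖1 + w‖ / 2 + k * (‖1 - w‖ / 2) := by
      have he : discEval z f = (1 / 2 : ℂ) * (1 + w) + t * conj d * ((1 - w) * discEval z g) := by
        simp only [f, q, discEval_add, discEval_smul, discEval_one, discEval_sub, discEval_mul]
        ring
      rw [he]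
      refine (norm_add_le _ _).trans (add_le_add ?_ ?_)
      · rw [norm_mul]; norm_num; linarith
      · rw [norm_mul, norm_mul, norm_mul, RCLike.norm_conj, Complex.norm_real,
          Real.norm_of_nonneg ht.le]
        calc t * D * (‖1 - w‖ * ‖discEval z g‖) ≤ t * D * (‖1 - w‖ * M) := by
              gcongr; exact norm_discEval_le z g
          _ = _ := by simp only [k]; ring
    set A := ‖1 + w‖ / 2 with hA
    set B := ‖1 - w‖ / 2 with hB
    have hAB : A ^ 2 + B ^ 2 ≤ 1 := by
      rw [hA, hB, div_pow, div_pow]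
      linarith [pow_le_one₀ (n := 2) (norm_nonneg w) hw]
    calc ‖discEval z f‖ ^ 2 ≤ (A + k * B) ^ 2 := by gcongr
      _ ≤ (1 + k ^ 2) * (A ^ 2 + B ^ 2) := by linarith [sq_nonneg (k * A - B)]
      _ ≤ 1 + k ^ 2 := mul_le_of_le_one_right (by positivity) hAB
  have h2 := (hξ f).trans hf
  rw [hval, Complex.norm_real, Real.norm_of_nonneg (by positivity)] at h2
  have h3 := (Real.le_sqrt (by positivity) (by positivity)).1 h2
  have h4 : t * (4 * M ^ 2 + 1) = 1 := inv_mul_cancel₀ (by positivity)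
  have h5 : k ^ 2 = t * D ^ 2 * (1 - t) := by
    simp only [k]; linear_combination t * D ^ 2 * h4
  have h6 : 0 < t * D ^ 2 := by positivity
  nlinarith [mul_pos h6 ht]

/-- Applying `contractive_functional_mul` at each boundary point, with `h` a rotation of the
coordinate, gives `T (discCoord * g) = ψ * T g`; induction then yields the powers. Surjectivity
plays no role. -/
theorem discEval_eq_of_contractive {T : discAlgebra →L[ℂ] discAlgebra} (hT : ∀ f, ‖T f‖ ≤ ‖f‖)
    {c : ℂ} (hc : ‖c‖ = 1) (h1 : T 1 = algebraMap ℂ discAlgebra c)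
    (hZ : ∀ x : ℂ, ‖x‖ = 1 → ‖discEval x (T discCoord)‖ = 1) (z : ℂ) (f : discAlgebra) :
    discEval z (T f) = c * discEval (discEval z (c⁻¹ • T discCoord)) f := by
  have hc0 : c ≠ 0 := norm_ne_zero_iff.1 (hc ▸ one_ne_zero)
  set ψ := c⁻¹ • T discCoord
  have hψ : ‖ψ‖ ≤ 1 := by
    rw [norm_smul, norm_inv, hc, inv_one, one_mul]
    exact (hT _).trans norm_discCoord_le
  have hmul : ∀ g, T (discCoord * g) = ψ * T g := fun g => by
    refine discAlgebra_ext_sphere fun x hx => ?_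
    rw [discEval_mul]
    set y := discEval x ψ with hy
    have hy1 : ‖y‖ = 1 := by
      rw [hy, discEval_smul, norm_mul, norm_inv, hc, inv_one, one_mul, hZ x hx]
    set ξ : discAlgebra →L[ℂ] ℂ := c⁻¹ • (discEvalCLM x).comp T
    have hξ : ∀ f, ξ f = c⁻¹ * discEval x (T f) := fun _ => rfl
    have key := contractive_functional_mul (ξ := ξ) (h := conj y • discCoord) (fun f => by
      rw [hξ, norm_mul, norm_inv, hc, inv_one, one_mul]
      exact (norm_discEval_le x _).trans (hT f)) (by
      rw [hξ, h1, discEval_algebraMap, inv_mul_cancel₀ hc0]) (by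
      rw [norm_smul, RCLike.norm_conj, hy1, one_mul]; exact norm_discCoord_le) (by
      rw [ξ.map_smul, hξ, ← discEval_smul, ← hy, smul_eq_mul, mul_comm, mul_conj_of_norm_one hy1]) g
    rw [smul_mul_assoc, ξ.map_smul, hξ, hξ, smul_eq_mul] at key
    linear_combination c * y * key + (y * discEval x (T g) -
      y * conj y * discEval x (T (discCoord * g))) * mul_inv_cancel₀ hc0 -
      discEval x (T (discCoord * g)) * mul_conj_of_norm_one hy1
  refine discEval_eq_of_discCoord_pow hψ (fun n => ?_) z f
  induction n with
  | zero => rw [pow_zero, pow_zero, h1, Algebra.algebraMap_eq_smul_one]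
  | succ n ih => rw [pow_succ', hmul, ih, mul_smul_comm, pow_succ']

/-! ### Operators in the reflexive hull -/

/-- The only way the hull is exploited: closed conditions at one vector pass from `S` to `T`. -/
theorem mem_of_mem_topologicalRef {𝕜 X : Type*} [Semiring 𝕜] [AddCommMonoid X] [Module 𝕜 X]
    [TopologicalSpace X] {S : Set (X →L[𝕜] X)} {T : X →L[𝕜] X} (hT : T ∈ topologicalRef S) (x : X)
    {K : Set X} (hK : IsClosed K) (h : ∀ L ∈ S, L x ∈ K) : T x ∈ K :=
  closure_minimal (by rintro _ ⟨L, hL, rfl⟩; exact h L hL) hK (hT x)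

theorem subset_topologicalRef {𝕜 X : Type*} [Semiring 𝕜] [AddCommMonoid X] [Module 𝕜 X]
    [TopologicalSpace X] (S : Set (X →L[𝕜] X)) : S ⊆ topologicalRef S :=
  fun L hL _ => subset_closure ⟨L, hL, rfl⟩

theorem topologicalRef_mono {𝕜 X : Type*} [Semiring 𝕜] [AddCommMonoid X] [Module 𝕜 X]
    [TopologicalSpace X] {S S' : Set (X →L[𝕜] X)} (h : S ⊆ S') :
    topologicalRef S ⊆ topologicalRef S' :=
  fun _ hT x => closure_mono (by rintro _ ⟨L, hL, rfl⟩; exact ⟨L, h hL, rfl⟩) (hT x)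

/-- The operators in the topological reflexive hull of the isometry group are unimodular multiples
of isometric automorphisms. -/
theorem exists_algEquiv_of_mem_topologicalRef {T : discAlgebra →L[ℂ] discAlgebra}
    (hT : T ∈ topologicalRef (isometryGroup ℂ discAlgebra)) :
    ∃ (c : ℂ) (e : discAlgebra ≃ₐ[ℂ] discAlgebra), ‖c‖ = 1 ∧ (∀ f, ‖e f‖ = ‖f‖) ∧
      ∀ f, T f = c • e f := by
  have hnorm : ∀ f, ‖T f‖ = ‖f‖ := fun f =>
    mem_of_mem_topologicalRef hT f (K := {g | ‖g‖ = ‖f‖})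
      (isClosed_eq continuous_norm continuous_const) (by
        rintro L ⟨S, hS⟩
        rw [hS]; exact S.norm_map f)
  obtain ⟨h1, hc⟩ : T 1 = algebraMap ℂ discAlgebra (discEval 0 (T 1)) ∧
      ‖discEval 0 (T 1)‖ = 1 := by
    refine mem_of_mem_topologicalRef hT 1
      (K := {g | g = algebraMap ℂ discAlgebra (discEval 0 g) ∧ ‖discEval 0 g‖ = 1}) ?_ ?_
    · refine (isClosed_eq continuous_id ?_).inter
        (isClosed_eq (continuous_discEval_left 0).norm continuous_const)
      exact (continuous_algebraMap ℂ discAlgebra).comp (continuous_discEval_left 0)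
    · rintro L ⟨S, hS⟩
      obtain ⟨c, hc, h⟩ := isometry_one S
      rw [hS, h]
      exact ⟨rfl, hc⟩
  set c := discEval 0 (T 1)
  have hc0 : c ≠ 0 := norm_ne_zero_iff.1 (hc ▸ one_ne_zero)
  have hZ : ∀ x : ℂ, ‖x‖ = 1 → ‖discEval x (T discCoord)‖ = 1 := fun x hx =>
    mem_of_mem_topologicalRef hT discCoord (K := {g | ‖discEval x g‖ = 1})
      (isClosed_eq (continuous_discEval_left x).norm continuous_const) (by
        rintro L ⟨S, hS⟩
        rw [hS]; exact norm_discEval_isometry_discCoord S hx)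
  have hP : PreservesPseudoHyperbolic (T discCoord) :=
    mem_of_mem_topologicalRef hT discCoord isClosed_preservesPseudoHyperbolic (by
      rintro L ⟨S, hS⟩
      rw [hS]; exact preservesPseudoHyperbolic_isometry S)
  have hcomp := discEval_eq_of_contractive (fun f => (hnorm f).le) hc h1 hZ
  have hci : ‖c⁻¹‖ = 1 := by rw [norm_inv, hc, inv_one]
  have hψ : ‖c⁻¹ • T discCoord‖ ≤ 1 := by
    rw [norm_smul, hci, one_mul, hnorm]; exact norm_discCoord_le
  -- Otherwise `ψ` is a constant `w`, and `T` kills the nonzero function `discCoord - w`, contrary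
  -- to `hnorm`.
  have h0 : ‖discEval 0 (c⁻¹ • T discCoord)‖ < 1 := by
    refine ((norm_discEval_le 0 _).trans hψ).lt_of_ne fun h => ?_
    have hconst := eq_algebraMap_of_norm_discEval_eq_one hψ (by simp) h
    set w := discEval 0 (c⁻¹ • T discCoord)
    have hTw : T (discCoord - algebraMap ℂ discAlgebra w) = 0 := by
      rw [T.map_sub, ← smul_inv_smul₀ hc0 (T discCoord), hconst, Algebra.algebraMap_eq_smul_one w,
        T.map_smul, h1, Algebra.algebraMap_eq_smul_one c, smul_comm, sub_self]
    have hd : discCoord = algebraMap ℂ discAlgebra w := by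
      rw [← sub_eq_zero, ← norm_eq_zero, ← hnorm, hTw, norm_zero]
    have e0 := congrArg (discEval 0) hd
    have e1 := congrArg (discEval 1) hd
    rw [discEval_discCoord (by simp), discEval_algebraMap] at e0 e1
    exact zero_ne_one (e0.trans e1.symm)
  obtain ⟨χ, hχ, hl, hr⟩ := (hP.smul hci).exists_inverse hψ h0
  have hψb := norm_discEval_lt_one hψ h0
  set ψ := c⁻¹ • T discCoord
  have hχ1 : ∀ z : ℂ, ‖z‖ ≤ 1 → ‖discEval z χ‖ ≤ 1 := fun z hz => by
    refine closure_minimal (s := ball (0 : ℂ) 1) (t := {z | ‖discEval z χ‖ ≤ 1})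
      (fun w hw => (hχ w (mem_ball_zero_iff.1 hw)).le)
      (isClosed_le (continuous_discEval χ).norm continuous_const) ?_
    rw [closure_ball _ one_ne_zero]
    exact mem_closedBall_zero_iff.2 hz
  refine ⟨c, AlgEquiv.ofAlgHom (discComp ψ hψb) (discComp χ hχ) ?_ ?_, hc, fun f => ?_,
    fun f => ?_⟩
  · refine AlgHom.ext fun f => discAlgebra_ext fun z hz => ?_
    change discEval z (discComp ψ hψb (discComp χ hχ f)) = discEval z f
    rw [discEval_discComp _ _ hz, discEval_discComp _ _ ((norm_discEval_le z ψ).trans hψ), hl z hz]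
  · refine AlgHom.ext fun f => discAlgebra_ext fun z hz => ?_
    change discEval z (discComp χ hχ (discComp ψ hψb f)) = discEval z f
    rw [discEval_discComp _ _ hz, discEval_discComp _ _ (hχ1 z hz), hr z hz]
  · change ‖discComp ψ hψb f‖ = ‖f‖
    have : T f = c • discComp ψ hψb f := discAlgebra_ext fun z hz =>
      (hcomp z f).trans (congrArg (c * ·) (discEval_discComp hψb f hz).symm)
    rw [← hnorm f, this, norm_smul, hc, one_mul]
  · refine discAlgebra_ext fun z hz =>
      (hcomp z f).trans (congrArg (c * ·) (discEval_discComp hψb f hz).symm)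

/-! ### Automorphisms are isometries, and the conclusion -/

theorem le_of_forall_pow_le_mul_pow {a b C : ℝ} (hb : 0 ≤ b)
    (h : ∀ n : ℕ, a ^ n ≤ C * b ^ n) (h0 : b = 0 → a = 0) : a ≤ b := by
  rcases hb.eq_or_lt with hb | hb
  · exact (h0 hb.symm).le.trans_eq hb
  · by_contra! hab
    obtain ⟨n, hn⟩ := pow_unbounded_of_one_lt C ((one_lt_div hb).2 hab)
    rw [div_pow, lt_div_iff₀ (pow_pos hb n)] at hn
    exact (h n).not_gt hn

/-- The sup norm is power-multiplicative, so `‖F f‖ ^ n ≤ ‖F‖ * ‖f‖ ^ n` for all `n`, and the factor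
`‖F‖` disappears on taking roots. -/
theorem norm_le_of_map_pow {F : discAlgebra →L[ℂ] discAlgebra}
    (hF : ∀ (f : discAlgebra) (n : ℕ), F (f ^ n) = F f ^ n) (f : discAlgebra) : ‖F f‖ ≤ ‖f‖ := by
  refine le_of_forall_pow_le_mul_pow (C := ‖F‖) (norm_nonneg f) (fun n => ?_) fun h0 => ?_
  · obtain ⟨x, -, hx⟩ := exists_norm_discEval_eq (F f)
    rw [← hx, ← norm_pow, ← discEval_pow, ← hF]
    refine (norm_discEval_le x _).trans ((F.le_opNorm _).trans ?_)
    refine mul_le_mul_of_nonneg_left (discNorm_le (by positivity) fun z _ => ?_) (norm_nonneg F)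
    rw [discEval_pow, norm_pow]
    exact pow_le_pow_left₀ (norm_nonneg _) (norm_discEval_le z f) n
  · rw [norm_eq_zero.1 h0, F.map_zero, norm_zero]

/-- Both an automorphism and its inverse are contractive. -/
theorem automorphismGroup_subset_isometryGroup :
    automorphismGroup ℂ discAlgebra ⊆ isometryGroup ℂ discAlgebra := by
  rintro T ⟨e, he⟩
  have hn : ∀ E : discAlgebra ≃A[ℂ] discAlgebra, ∀ f, ‖E f‖ ≤ ‖f‖ := fun E =>
    norm_le_of_map_pow (F := ⟨E.toAlgEquiv.toLinearMap, E.continuous⟩)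
      fun f n => map_pow E.toAlgEquiv f n
  refine ⟨⟨e.toAlgEquiv.toLinearEquiv, fun f => (hn e f).antisymm ?_⟩, he⟩
  have := hn e.symm (e f)
  rwa [e.symm_apply_apply] at this

theorem mainTheorem5 :
    IsTopologicallyReflexive (isometryGroup ℂ discAlgebra) ∧
      IsTopologicallyReflexive (automorphismGroup ℂ discAlgebra) := by
  refine ⟨(subset_topologicalRef _).antisymm' fun T hT => ?_,
    (subset_topologicalRef _).antisymm' fun T hT => ?_⟩
  · obtain ⟨c, e, hc, he, hTe⟩ := exists_algEquiv_of_mem_topologicalRef hT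
    have hc0 : c ≠ 0 := norm_ne_zero_iff.1 (hc ▸ one_ne_zero)
    refine ⟨LinearIsometryEquiv.ofSurjective ⟨T.toLinearMap, fun f => ?_⟩ fun f => ?_, fun f => rfl⟩
    · change ‖T f‖ = ‖f‖
      rw [hTe, norm_smul, hc, one_mul, he]
    · refine ⟨c⁻¹ • e.symm f, ?_⟩
      change T (c⁻¹ • e.symm f) = f
      rw [T.map_smul, hTe, e.apply_symm_apply, inv_smul_smul₀ hc0]
  · have h1 : T 1 = 1 := mem_of_mem_topologicalRef hT 1 (K := {1}) isClosed_singleton (by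
      rintro L ⟨S, hS⟩
      rw [hS]; exact map_one S.toAlgEquiv)
    obtain ⟨c, e, hc, he, hTe⟩ := exists_algEquiv_of_mem_topologicalRef
      (topologicalRef_mono automorphismGroup_subset_isometryGroup hT)
    have hc1 : c = 1 := by
      have := congrArg (discEval 0) (hTe 1)
      rw [h1, map_one e, discEval_smul, discEval_one, mul_one] at this
      exact this.symm
    have hes : ∀ f, ‖e.symm f‖ = ‖f‖ := fun f => by rw [← he, e.apply_symm_apply]
    exact ⟨{ e with
      continuous_toFun := AddMonoidHomClass.continuous_of_bound e 1 fun f => by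
        rw [one_mul, he]
      continuous_invFun := AddMonoidHomClass.continuous_of_bound e.symm 1 fun f => by
        rw [one_mul, hes] }, fun f => by rw [hTe, hc1, one_smul]; rfl⟩
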